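/- Manifolds are finite-dimensional smooth ($C^\infty$) manifolds without boundary, not necessarily Hausdorff or second countable. Let $G$ be a separable Lie group acting smoothly on a manifold $X$, let $x\in X$, and let $r$ be the rank at the identity of the orbital map $G\to X$, $\xi\mapsto \xi x$. Give the orbit $Gx$ the quotient topology of the map $\rho:G\to Gx$, $\xi\mapsto\xi x$ (equivalently, the topology transported from $G/G_x$ by the canonical bijection $G/G_x\to Gx$), and the atlas of all homeomorphisms $\varphi$ from an open subset of $Gx$ onto an open subset of $\mathbb{R}^r$ such that $\varphi\circ\rho$ is smooth on $\rho^{-1}(\operatorname{dom}\varphi)$ and $\varphi^{-1}$ is smooth as a map into $X$. With this structure $Gx$ is a smooth manifold, the inclusion $Gx\to X$ is an immersion (so $Gx$ is an immersed submanifold of $X$), and $\rho:G\to Gx$ is smooth. Moreover, for every $k$ with $1\le k\le\infty$, every $C^k$ curve $c:T\to X$ on an open interval $T\ni 0$ with $c(0)=x$ and $c(T)\subseteq Gx$ is a $C^k$ curve in $Gx$, i.e. it is $C^k$ as a map from $T$ to the immersed submanifold $Gx$. -/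

import Mathlib

open Set
open scoped Manifold ContDiff

/-- The orbit `Gx` of a point `x`, as a type of its own, so that it does not carry the topology
induced from the ambient space. -/
def Orbit (G : Type*) {X : Type*} [Group G] [MulAction G X] (x : X) : Type _ :=
  MulAction.orbit G x

namespace Orbit

/-- The inclusion `Gx → X`. -/
def incl {G X : Type*} [Group G] [MulAction G X] {x : X} (p : Orbit G x) : X :=
  Subtype.val (p := fun y => y ∈ MulAction.orbit G x) p

/-- The orbital map `G → Gx`, `g ↦ g x`. -/
def proj {G X : Type*} [Group G] [MulAction G X] (x : X) (g : G) : Orbit G x :=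
  (⟨g • x, MulAction.mem_orbit x g⟩ : MulAction.orbit G x)

/-- The topology of `Gx` is the quotient topology of the orbital map `G → Gx`, that is, the
topology carried over from `G / G_x` by the canonical bijection `G / G_x → Gx`. -/
instance {G X : Type*} [Group G] [TopologicalSpace G] [MulAction G X] (x : X) :
    TopologicalSpace (Orbit G x) :=
  TopologicalSpace.coinduced (proj x) inferInstance

section Smooth

variable {E H E' H' G X : Type*}
  [NormedAddCommGroup E] [NormedSpace ℝ E] [TopologicalSpace H]
  [NormedAddCommGroup E'] [NormedSpace ℝ E'] [TopologicalSpace H']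
  [Group G] [TopologicalSpace G] [ChartedSpace H' G]
  [TopologicalSpace X] [ChartedSpace H X] [MulAction G X]

/-- The rank of the orbital map `G → X`, `g ↦ g x`, at the identity. -/
noncomputable def dim (J : ModelWithCorners ℝ E' H') (I : ModelWithCorners ℝ E H)
    (G : Type*) [Group G] [TopologicalSpace G] [ChartedSpace H' G] [MulAction G X] (x : X) : ℕ :=
  Module.finrank ℝ
    (LinearMap.range (mfderiv J I (fun g : G => g • x) (1 : G)).toLinearMap)

/-- The smooth atlas of `Gx`: the charts are the homeomorphisms `φ` from an open subset of `Gx`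
onto an open subset of `ℝ^r`, `r` being the rank of the orbital map, such that `φ` composed with
the orbital map `G → Gx` is smooth and `φ⁻¹` composed with the inclusion `Gx → X` is smooth. -/
def smoothAtlas (J : ModelWithCorners ℝ E' H') (I : ModelWithCorners ℝ E H)
    (G : Type*) [Group G] [TopologicalSpace G] [ChartedSpace H' G] [MulAction G X] (x : X) :
    Set (OpenPartialHomeomorph (Orbit G x) (EuclideanSpace ℝ (Fin (dim J I G x)))) :=
  {φ | ContMDiffOn J 𝓘(ℝ, EuclideanSpace ℝ (Fin (dim J I G x))) ∞
        (fun g : G => φ (proj x g)) (proj x ⁻¹' φ.source) ∧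
      ContMDiffOn 𝓘(ℝ, EuclideanSpace ℝ (Fin (dim J I G x))) I ∞
        (fun v => incl (φ.symm v)) φ.target}

end Smooth

end Orbit

/-!
The proof rests on one kind of chart of `X` (`SliceChart`). Write `μ` for the orbital map
`g ↦ g • x`, `r` for its rank at the identity, and choose a complement `C` of the range of the
derivative of `μ` at the identity. Choose also smooth maps `s` from `V = ℝ^r` to `G` with `s 0 = 1`,
whose derivative at `0` is carried by that of `μ` onto this range, and `κ` from `C` to `X` with
`κ 0 = x`, whose derivative at `0` is the inclusion. By the inverse function theorem,
`(u, z) ↦ s u • κ z` is near `0` the inverse of a chart of `X`.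

In this chart the transverse coordinate, with values in `C`, is locally constant along `μ`
(`isOpen_level_of_product_chart`). By equivariance the rank of `μ` is at most `r` everywhere, and
each plaque `V × z` that meets the orbit lies in it and is the image under `μ` of a smooth family in
`G`. So the range of the derivative of `μ` is the tangent space of the plaque, on which the
transverse coordinate has derivative zero. This replaces the constant rank theorem.

Consequently the plaque `V × 0` is an open subset of `Gx` in the quotient topology, and the
coordinate in `V` is a chart of `Gx` (`SliceChart.orbitChart`), whose inverse lifts smoothly to `G`
by `s`. The lift makes all charts of the smooth atlas compatible
(`SliceChart.contDiffOn_symm_trans`), and in slice charts the inclusion reads `u ↦ (u, 0)`.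
Translation by `G` carries all this from `x` to the other points of the orbit.

For a curve in `Gx` that is continuous into `X`, separability of `G` leaves only countably many
values to the transverse coordinate, which is therefore locally constant along the curve
(`SliceChart.eventually_mem_slice`). So the curve stays locally in a plaque, where its coordinate in
`V` is as smooth as the curve is in `X`.
-/

/-! ### Linear algebra and calculus -/

/-- A linear map into `V × C` of rank at most `dim V` whose range contains `V × 0` has range exactly
`V × 0`. -/
theorem snd_eq_zero_of_finrank_range_le {V C W : Type*} [AddCommGroup V] [Module ℝ V]
    [AddCommGroup C] [Module ℝ C] [AddCommGroup W] [Module ℝ W] [FiniteDimensional ℝ W]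
    (N : W →ₗ[ℝ] V × C) (hr : Module.finrank ℝ (LinearMap.range N) ≤ Module.finrank ℝ V)
    (hV : ∀ v : V, (v, (0 : C)) ∈ LinearMap.range N) (w : W) : (N w).2 = 0 := by
  have hle : LinearMap.range (LinearMap.inl ℝ V C) ≤ LinearMap.range N := by
    rintro _ ⟨v, rfl⟩
    exact hV v
  have heq := Submodule.eq_of_le_of_finrank_le hle
    (by rwa [LinearMap.finrank_range_of_inj LinearMap.inl_injective])
  obtain ⟨v, hv⟩ : N w ∈ LinearMap.range (LinearMap.inl ℝ V C) := heq ▸ LinearMap.mem_range_self N w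
  rw [← hv]
  rfl

/-- The range of `M`, parametrized through a section `S` of `M` by a Euclidean space, together with
a complement `C`, decomposes the codomain. -/
theorem exists_complement_equiv_range {W E : Type*} [NormedAddCommGroup W] [NormedSpace ℝ W]
    [NormedAddCommGroup E] [NormedSpace ℝ E]
    [FiniteDimensional ℝ E] (M : W →ₗ[ℝ] E) :
    ∃ (C : Submodule ℝ E)
      (S : EuclideanSpace ℝ (Fin (Module.finrank ℝ (LinearMap.range M))) →L[ℝ] W)
      (L : (EuclideanSpace ℝ (Fin (Module.finrank ℝ (LinearMap.range M))) × C) ≃L[ℝ] E),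
      ∀ p, L p = M (S p.1) + p.2 := by
  obtain ⟨C, hC⟩ := Submodule.exists_isCompl (LinearMap.range M)
  obtain ⟨R, hR⟩ := M.rangeRestrict.exists_rightInverse_of_surjective M.range_rangeRestrict
  let e : EuclideanSpace ℝ (Fin (Module.finrank ℝ (LinearMap.range M))) ≃ₗ[ℝ] LinearMap.range M :=
    LinearEquiv.ofFinrankEq _ _ (by simp)
  refine ⟨C, LinearMap.toContinuousLinearMap (R ∘ₗ e.toLinearMap),
    ((e.prodCongr (LinearEquiv.refl ℝ C)).trans
      (Submodule.prodEquivOfIsCompl _ _ hC)).toContinuousLinearEquiv, fun p => ?_⟩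
  have h := congrArg Subtype.val (LinearMap.congr_fun hR (e p.1))
  simp only [LinearMap.comp_apply, LinearMap.id_apply, LinearMap.codRestrict_apply,
    LinearMap.rangeRestrict] at h
  simp [h]

/-- The inverse function theorem, with an inverse that is smooth on a whole neighbourhood. -/
theorem exists_openPartialHomeomorph_of_hasFDerivAt {P E : Type*} [NormedAddCommGroup P]
    [NormedSpace ℝ P] [CompleteSpace P] [NormedAddCommGroup E] [NormedSpace ℝ E]
    {f : P → E} {s : Set P} (hs : IsOpen s) (hf : ContDiffOn ℝ ∞ f s) {p : P} (hp : p ∈ s)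
    (L : P ≃L[ℝ] E) (hL : HasFDerivAt f (L : P →L[ℝ] E) p) :
    ∃ e : OpenPartialHomeomorph P E, p ∈ e.source ∧ e.source ⊆ s ∧ (∀ v, e v = f v) ∧
      ContDiffOn ℝ ∞ e.symm e.target := by
  have hfp : ContDiffAt ℝ ∞ f p := hf.contDiffAt (hs.mem_nhds hp)
  -- restrict to the open set where the derivative stays invertible, so that the inverse is
  -- smooth everywhere and not merely at the image of `p`
  let t : Set P := s ∩ fderiv ℝ f ⁻¹' range ((↑) : (P ≃L[ℝ] E) → P →L[ℝ] E)
  have ht : IsOpen t :=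
    (hf.continuousOn_fderiv_of_isOpen hs (by simp)).isOpen_inter_preimage hs
      ContinuousLinearEquiv.isOpen
  let e := (hfp.toOpenPartialHomeomorph f hL (by simp)).restrOpen t ht
  have hpt : p ∈ t := ⟨hp, L, hL.fderiv.symm⟩
  have hsrc : e.source ⊆ t := inter_subset_right
  refine ⟨e, ⟨hfp.mem_toOpenPartialHomeomorph_source hL (by simp), hpt⟩,
    hsrc.trans inter_subset_left, fun _ => rfl, fun y hy => ?_⟩
  obtain ⟨h1, A, hA⟩ := hsrc (e.map_target hy)
  have hd : ContDiffAt ℝ ∞ f (e.symm y) := hf.contDiffAt (hs.mem_nhds h1)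
  exact (e.contDiffAt_symm (f₀' := A) hy
    (hA ▸ (hd.differentiableAt (by simp)).hasFDerivAt) hd).contDiffWithinAt

/-! ### Calculus on manifolds -/

section Manifold

variable {E H X : Type*} [NormedAddCommGroup E] [NormedSpace ℝ E] [TopologicalSpace H]
  {I : ModelWithCorners ℝ E H} [I.Boundaryless]
  [TopologicalSpace X] [ChartedSpace H X] [IsManifold I ∞ X]

/-- A map whose derivative vanishes on an open set is locally constant there. -/
theorem isOpen_inter_preimage_of_mfderiv_eq_zero {C : Type*} [NormedAddCommGroup C]
    [NormedSpace ℝ C] {f : X → C} {s : Set X} (hs : IsOpen s)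
    (hf : ∀ y ∈ s, HasMFDerivAt I 𝓘(ℝ, C) f y 0) (t : Set C) :
    IsOpen (s ∩ f ⁻¹' t) := by
  rw [isOpen_iff_mem_nhds]
  rintro y ⟨hys, hyt⟩
  have : IsManifold I 1 X := .of_le (n := ∞) (by simp)
  let φ := extChartAt I y
  let u : Set E := φ.target ∩ φ.symm ⁻¹' s
  have hu : IsOpen u :=
    (continuousOn_extChartAt_symm y).isOpen_inter_preimage (isOpen_extChartAt_target y) hs
  have hd : ∀ v ∈ u, HasFDerivAt (f ∘ φ.symm) (0 : E →L[ℝ] C) v := by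
    intro v hv
    have h1 : MDifferentiableAt 𝓘(ℝ, E) I φ.symm v :=
      ((contMDiffOn_extChartAt_symm (n := 1) y).contMDiffAt
        ((isOpen_extChartAt_target y).mem_nhds hv.1)).mdifferentiableAt (by simp)
    have h2 := (hf _ hv.2).comp v h1.hasMFDerivAt
    rw [hasMFDerivAt_iff_hasFDerivAt] at h2
    convert! h2 using 1
  have h := hu.isOpen_inter_preimage_of_fderiv_eq_zero
    (fun v hv => (hd v hv).differentiableAt.differentiableWithinAt)
    (fun v hv => (hd v hv).fderiv) t
  have h3 : IsOpen (φ.source ∩ φ ⁻¹' (u ∩ (f ∘ φ.symm) ⁻¹' t)) :=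
    isOpen_extChartAt_preimage' y h
  refine Filter.mem_of_superset (h3.mem_nhds ?_) ?_
  · have hy : y ∈ φ.source := mem_extChartAt_source y
    refine ⟨hy, ⟨φ.map_source hy, ?_⟩, ?_⟩ <;> simpa [φ.left_inv hy]
  · rintro z ⟨hz, ⟨-, h4⟩, h5⟩
    simp only [mem_preimage, Function.comp_apply, φ.left_inv hz] at h4 h5
    exact ⟨h4, h5⟩

/-- The inverse function theorem for a map from a Banach space to a manifold: a smooth map with
invertible derivative at `p` is, near `p`, the inverse of a smooth chart. -/
theorem exists_chart_of_hasMFDerivAt_equiv {P : Type*} [NormedAddCommGroup P]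
    [NormedSpace ℝ P] [CompleteSpace P] {f : P → X} {s : Set P} (hs : IsOpen s)
    (hf : ContMDiffOn 𝓘(ℝ, P) I ∞ f s) {p : P} (hp : p ∈ s) (L : P ≃L[ℝ] E)
    (hL : HasMFDerivAt 𝓘(ℝ, P) I f p (L : P →L[ℝ] E)) :
    ∃ e : OpenPartialHomeomorph X P, p ∈ e.target ∧ e.target ⊆ s ∧
      (∀ v ∈ e.target, e.symm v = f v) ∧
      ContMDiffOn I 𝓘(ℝ, P) ∞ e e.source ∧ ContMDiffOn 𝓘(ℝ, P) I ∞ e.symm e.target := by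
  have : IsManifold I 1 X := .of_le (n := ∞) (by simp)
  let c : OpenPartialHomeomorph X E :=
    (chartAt H (f p)).trans I.toHomeomorph.toOpenPartialHomeomorph
  have hcs : c.source = (chartAt H (f p)).source := by simp [c]
  have hct : c.target = (extChartAt I (f p)).target := by
    simp [c, I.range_eq_univ]; rfl
  have hc : ContMDiffOn I 𝓘(ℝ, E) ∞ c c.source := hcs ▸ contMDiffOn_extChartAt (I := I)
  let u : Set P := s ∩ f ⁻¹' c.source
  have hu : IsOpen u := hf.continuousOn.isOpen_inter_preimage hs c.open_source
  have hpu : p ∈ u := ⟨hp, by simp [hcs]⟩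
  have hF : ContDiffOn ℝ ∞ (c ∘ f) u :=
    (hc.comp (hf.mono inter_subset_left) inter_subset_right).contDiffOn
  obtain ⟨A₀, hA⟩ := isInvertible_mfderiv_extChartAt (I := I) (mem_extChartAt_source (f p))
  let A : E ≃L[ℝ] E := A₀
  have hcd : HasMFDerivAt I 𝓘(ℝ, E) c (f p) (A : E →L[ℝ] E) := by
    have h1 := ((contMDiffAt_extChartAt (I := I) (n := 1) (x := f p)).mdifferentiableAt
      (by simp)).hasMFDerivAt
    rw [← hA] at h1
    exact h1
  have hFd : HasFDerivAt (c ∘ f) ((L.trans A : P ≃L[ℝ] E) : P →L[ℝ] E) p := by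
    have h1 := hcd.comp p hL
    rw [hasMFDerivAt_iff_hasFDerivAt] at h1
    exact h1
  obtain ⟨e, hpe, heu, hef, hes⟩ := exists_openPartialHomeomorph_of_hasFDerivAt hu hF hpu _ hFd
  have htgt : (c.trans e.symm).target = e.source := by
    rw [OpenPartialHomeomorph.trans_target]
    refine inter_eq_left.2 fun v hv => ?_
    change e v ∈ c.target
    rw [hef]
    exact c.map_source (heu hv).2
  have hsymm : ∀ v ∈ e.source, (c.trans e.symm).symm v = f v := by
    intro v hv
    change c.symm (e v) = f v
    rw [hef]
    exact c.left_inv (heu hv).2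
  refine ⟨c.trans e.symm, htgt ▸ hpe, htgt ▸ heu.trans inter_subset_left, htgt ▸ hsymm, ?_, ?_⟩
  · rw [OpenPartialHomeomorph.trans_source]
    exact hes.contMDiffOn.comp (hc.mono inter_subset_left) inter_subset_right
  · rw [htgt]
    exact (hf.mono (heu.trans inter_subset_left)).congr hsymm

/-- Every linear map into a tangent space is the derivative of some smooth map into the
manifold. -/
theorem exists_contMDiffOn_hasMFDerivAt {V : Type*} [NormedAddCommGroup V] [NormedSpace ℝ V]
    (x : X) (A : V →L[ℝ] E) :
    ∃ (f : V → X) (s : Set V), IsOpen s ∧ (0 : V) ∈ s ∧ ContMDiffOn 𝓘(ℝ, V) I ∞ f s ∧ f 0 = x ∧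
      HasMFDerivAt 𝓘(ℝ, V) I f 0 A := by
  have : IsManifold I 1 X := .of_le (n := ∞) (by simp)
  let φ := extChartAt I x
  have hinv := isInvertible_mfderivWithin_extChartAt_symm (I := I) (mem_extChartAt_target x)
  rw [I.range_eq_univ, mfderivWithin_univ] at hinv
  obtain ⟨B, hB⟩ := hinv
  let B' : E ≃L[ℝ] E := B
  let l : V → E := fun v => φ x + B'.symm (A v)
  have hl : ContDiff ℝ ∞ l := by fun_prop
  have hl0 : l 0 = φ x := by simp [l]
  have hφ : ContMDiffOn 𝓘(ℝ, E) I ∞ φ.symm φ.target := contMDiffOn_extChartAt_symm x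
  refine ⟨φ.symm ∘ l, l ⁻¹' φ.target, (isOpen_extChartAt_target x).preimage hl.continuous, ?_,
    hφ.comp hl.contMDiff.contMDiffOn subset_rfl, ?_, ?_⟩
  · rw [mem_preimage, hl0]
    exact mem_extChartAt_target x
  · rw [Function.comp_apply, hl0]
    exact extChartAt_to_inv x
  · have h1 : HasMFDerivAt 𝓘(ℝ, E) I φ.symm (φ x) (B' : E →L[ℝ] E) := by
      have h2 := ((hφ.contMDiffAt ((isOpen_extChartAt_target x).mem_nhds
        (mem_extChartAt_target x))).mdifferentiableAt (by simp)).hasMFDerivAt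
      rw [← hB] at h2
      exact h2
    have h3 : HasMFDerivAt 𝓘(ℝ, V) 𝓘(ℝ, E) l 0 ((B'.symm : E →L[ℝ] E) ∘L A) :=
      (((B'.symm : E →L[ℝ] E) ∘L A).hasFDerivAt.const_add (φ x)).hasMFDerivAt
    rw [← hl0] at h1
    have h4 : ∀ D : V →L[ℝ] E, D = (B' : E →L[ℝ] E) ∘L ((B'.symm : E →L[ℝ] E) ∘L A) →
        HasMFDerivAt 𝓘(ℝ, V) I (φ.symm ∘ l) 0 D := by
      rintro _ rfl
      exact h1.comp (0 : V) h3
    exact h4 A (by ext v; simp)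

end Manifold

/-! ### The rank of the orbital map and slice charts -/

section Slice

variable {E H E' H' G X : Type*}
  [NormedAddCommGroup E] [NormedSpace ℝ E] [TopologicalSpace H]
  {I : ModelWithCorners ℝ E H} [TopologicalSpace X] [ChartedSpace H X]
  [NormedAddCommGroup E'] [NormedSpace ℝ E'] [TopologicalSpace H']
  {J : ModelWithCorners ℝ E' H'} [Group G] [TopologicalSpace G] [ChartedSpace H' G]
  [MulAction G X]

theorem contMDiff_smul_const [ContMDiffSMul J I ∞ G X] (x : X) :
    ContMDiff J I ∞ (fun g : G => g • x) :=
  contMDiff_id.smul (I := J) contMDiff_const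

theorem hasMFDerivAt_smul_const [ContMDiffSMul J I ∞ G X] (x : X) (g : G) :
    HasMFDerivAt J I (fun g : G => g • x) g (mfderiv J I (fun g : G => g • x) g) :=
  ((contMDiff_smul_const x).mdifferentiableAt (by simp)).hasMFDerivAt

/-- By equivariance, the rank of the orbital map is nowhere larger than at the identity. -/
theorem finrank_range_mfderiv_smul_const_le [FiniteDimensional ℝ E'] [FiniteDimensional ℝ E]
    [LieGroup J ∞ G]
    [ContMDiffSMul J I ∞ G X] (x : X) (g : G) :
    Module.finrank ℝ (LinearMap.range (mfderiv J I (fun g : G => g • x) g).toLinearMap) ≤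
      Orbit.dim J I G x := by
  let μ : G → X := fun g => g • x
  have h1 : ∀ k : G, k = 1 → HasMFDerivAt J I μ k (mfderiv J I μ 1 : E' →L[ℝ] E) := by
    rintro _ rfl
    exact hasMFDerivAt_smul_const x 1
  have h2 := (((contMDiff_mul_left (I := J) (n := ∞) (a := g⁻¹)).mdifferentiableAt
    (x := g) (by simp))).hasMFDerivAt
  have h3 := (h1 (g⁻¹ * g) (inv_mul_cancel g)).comp g h2
  have h4 := ((ContMDiffSMul.contMDiff_const_smul (I := J) (I' := I) (n := ∞) g).mdifferentiableAt
    (x := (g⁻¹ * g) • x) (by simp)).hasMFDerivAt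
  have h5 := h4.comp g h3
  -- `μ` is its own conjugate by translation with `g`, which moves `1` to `g`
  have h6 : (fun y : X => g • y) ∘ μ ∘ (fun h => g⁻¹ * h) = μ := by
    funext h
    simp [μ, smul_smul]
  rw [h6] at h5
  have h7 := hasMFDerivAt_unique h5 (hasMFDerivAt_smul_const x g)
  rw [← h7]
  let A : E' →ₗ[ℝ] E' := (mfderiv J J (fun h => g⁻¹ * h) g : E' →L[ℝ] E').toLinearMap
  let B : E' →ₗ[ℝ] E := (mfderiv J I μ 1 : E' →L[ℝ] E).toLinearMap
  let D : E →ₗ[ℝ] E := (mfderiv I I (fun y : X => g • y) ((g⁻¹ * g) • x) : E →L[ℝ] E).toLinearMap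
  change Module.finrank ℝ (LinearMap.range (D ∘ₗ B ∘ₗ A)) ≤ Module.finrank ℝ (LinearMap.range B)
  rw [LinearMap.range_comp]
  refine (Submodule.finrank_map_le _ _).trans (Submodule.finrank_mono ?_)
  exact LinearMap.range_comp_le_range _ _

/-- A chart of `X` around `g • x` with values in a product `V × C`, adapted to the orbit of `x`:
the plaque `V × 0` lifts smoothly to `G` along the orbital map, and along the orbit, in the topology
of `G`, the transverse coordinate in `C` is locally constant. -/
structure SliceChart (J : ModelWithCorners ℝ E' H') (I : ModelWithCorners ℝ E H) (x : X) (g : G)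
    (V C : Type*) [NormedAddCommGroup V] [NormedSpace ℝ V] [NormedAddCommGroup C]
    [NormedSpace ℝ C] where
  /-- The chart of the ambient manifold. -/
  chart : OpenPartialHomeomorph X (V × C)
  /-- The lift of the plaque `V × 0` to the group. Its values outside the plaque are irrelevant. -/
  lift : V → G
  contMDiffOn_chart : ContMDiffOn I 𝓘(ℝ, V × C) ∞ chart chart.source
  contMDiffOn_symm : ContMDiffOn 𝓘(ℝ, V × C) I ∞ chart.symm chart.target
  contMDiffOn_lift : ContMDiffOn 𝓘(ℝ, V) J ∞ lift {u | (u, (0 : C)) ∈ chart.target}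
  lift_smul : ∀ u, (u, (0 : C)) ∈ chart.target → lift u • x = chart.symm (u, 0)
  /-- The transverse coordinate of `h • x` is a locally constant function of `h`. -/
  isOpen_level : ∀ a : C, IsOpen {h : G | h • x ∈ chart.source ∧ (chart (h • x)).2 = a}
  mem_source : g • x ∈ chart.source
  snd_eq_zero : (chart (g • x)).2 = 0

/-- If the inverse of a chart of `X` has the form `(u, z) ↦ s u • κ z`, then its transverse coordinate
is locally constant along the orbital map. Indeed the derivative of the orbital map at `h`, read in
the chart, has rank at most `dim V`, and its range contains `V × 0`, since the plaque through `h • x`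
is contained in the orbit and lifts to `G`. So the derivative of the transverse coordinate
vanishes. -/
theorem isOpen_level_of_product_chart [J.Boundaryless]
    [FiniteDimensional ℝ E] [FiniteDimensional ℝ E'] [LieGroup J ∞ G] [IsManifold I ∞ X]
    [ContMDiffSMul J I ∞ G X] {x : X} {V C : Type*}
    [NormedAddCommGroup V] [NormedSpace ℝ V] [NormedAddCommGroup C] [NormedSpace ℝ C]
    (hV : Orbit.dim J I G x ≤ Module.finrank ℝ V) (e : OpenPartialHomeomorph X (V × C))
    (he : ContMDiffOn I 𝓘(ℝ, V × C) ∞ e e.source)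
    {s : V → G} {κ : C → X} {a : Set V} (ha : IsOpen a) (hs : ContMDiffOn 𝓘(ℝ, V) J ∞ s a)
    (hea : ∀ p ∈ e.target, p.1 ∈ a) (hsymm : ∀ p ∈ e.target, e.symm p = s p.1 • κ p.2) (c : C) :
    IsOpen {h : G | h • x ∈ e.source ∧ (e (h • x)).2 = c} := by
  have := ContMDiffSMul.continuousSMul (I := J) (I' := I) (G := G) (M := X) ∞
  have : IsManifold J ∞ G := ContMDiffMul.toIsManifold (I := J)
  let μ : G → X := fun g => g • x
  have hμ : Continuous μ := (contMDiff_smul_const (J := J) (I := I) x).continuous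
  have hO : IsOpen (μ ⁻¹' e.source) := e.open_source.preimage hμ
  refine isOpen_inter_preimage_of_mfderiv_eq_zero (I := J) (f := fun h : G => (e (h • x)).2) hO
    (fun h hh => ?_) {c}
  have heμ : HasMFDerivAt I 𝓘(ℝ, V × C) e (μ h) (mfderiv I 𝓘(ℝ, V × C) e (μ h)) :=
    ((he.contMDiffAt (e.open_source.mem_nhds hh)).mdifferentiableAt (by simp)).hasMFDerivAt
  let A : E' →L[ℝ] E := mfderiv J I μ h
  let B : E →L[ℝ] V × C := mfderiv I 𝓘(ℝ, V × C) e (μ h)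
  have hN : HasMFDerivAt J 𝓘(ℝ, V × C) (e ∘ μ) h (B ∘L A) :=
    heμ.comp h (hasMFDerivAt_smul_const x h)
  set q := e (μ h) with hq
  have hqt : q ∈ e.target := e.map_source hh
  -- the plaque through `h • x` is the image under `μ` of `u ↦ s u * ((s q.1)⁻¹ * h)`
  let τ : V → G := fun u => s u * ((s q.1)⁻¹ * h)
  have hτ0 : τ q.1 = h := by simp [τ]
  have hτ : MDifferentiableAt 𝓘(ℝ, V) J τ q.1 := by
    refine ContMDiffAt.mdifferentiableAt (n := ∞) ?_ (by simp)
    exact (hs.contMDiffAt (ha.mem_nhds (hea q hqt))).mul contMDiffAt_const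
  have hκ : κ q.2 = ((s q.1)⁻¹ * h) • x := by
    rw [mul_smul, eq_inv_smul_iff, ← hsymm q hqt, hq, e.left_inv hh]
  have hev : (e ∘ μ) ∘ τ =ᶠ[nhds q.1] fun u => (u, q.2) := by
    have hc : Continuous (fun u : V => (u, q.2)) := by fun_prop
    filter_upwards [(e.open_target.preimage hc).mem_nhds hqt] with u hu
    have : τ u • x = e.symm (u, q.2) := by
      rw [hsymm _ hu, hκ]
      simp [τ, mul_smul]
    simp only [Function.comp_apply, μ, this]
    exact e.right_inv hu
  have hinl : ∀ v : V, (B ∘L A) ((mfderiv 𝓘(ℝ, V) J τ q.1 : V →L[ℝ] E') v) = (v, (0 : C)) := by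
    intro v
    have h1 : HasMFDerivAt J 𝓘(ℝ, V × C) (e ∘ μ) (τ q.1) (B ∘L A) := by
      rw [hτ0]; exact hN
    have h2 := h1.comp q.1 hτ.hasMFDerivAt
    have h3 : HasMFDerivAt 𝓘(ℝ, V) 𝓘(ℝ, V × C) ((e ∘ μ) ∘ τ) q.1
        (ContinuousLinearMap.inl ℝ V C) := by
      refine HasMFDerivAt.congr_of_eventuallyEq ?_ hev
      exact ((hasFDerivAt_id (𝕜 := ℝ) q.1).prodMk (hasFDerivAt_const q.2 q.1)).hasMFDerivAt
    exact DFunLike.congr_fun (hasMFDerivAt_unique h2 h3) v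
  have hrank : Module.finrank ℝ (LinearMap.range (B ∘L A).toLinearMap) ≤ Module.finrank ℝ V := by
    refine le_trans ?_ ((finrank_range_mfderiv_smul_const_le (J := J) (I := I) x h).trans hV)
    change Module.finrank ℝ (LinearMap.range (B.toLinearMap ∘ₗ A.toLinearMap)) ≤
      Module.finrank ℝ (LinearMap.range A.toLinearMap)
    rw [LinearMap.range_comp]
    exact Submodule.finrank_map_le _ _
  have hzero : (ContinuousLinearMap.snd ℝ V C) ∘L (B ∘L A) = 0 := by
    ext w
    exact snd_eq_zero_of_finrank_range_le (B ∘L A).toLinearMap hrank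
      (fun v => ⟨_, hinl v⟩) w
  have hfin : ∀ D : E' →L[ℝ] C, D = (ContinuousLinearMap.snd ℝ V C) ∘L (B ∘L A) →
      HasMFDerivAt J 𝓘(ℝ, C) (fun h : G => (e (h • x)).2) h D := by
    rintro _ rfl
    exact ((ContinuousLinearMap.snd ℝ V C).hasMFDerivAt (x := q)).comp h hN
  exact hfin 0 hzero.symm

/-- The slice chart at the identity is the local inverse of `(u, z) ↦ s u • κ z`, where `s` and `κ`
are smooth maps into `G` and `X` with derivatives `S` and `K` at `0`. -/
theorem exists_sliceChart_one_of_equiv [I.Boundaryless] [J.Boundaryless]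
    [FiniteDimensional ℝ E] [FiniteDimensional ℝ E'] [LieGroup J ∞ G] [IsManifold I ∞ X]
    [ContMDiffSMul J I ∞ G X] (x : X) {V C : Type*}
    [NormedAddCommGroup V] [NormedSpace ℝ V] [CompleteSpace V]
    [NormedAddCommGroup C] [NormedSpace ℝ C] [CompleteSpace C]
    (hV : Orbit.dim J I G x ≤ Module.finrank ℝ V) (S : V →L[ℝ] E') (K : C →L[ℝ] E)
    (L : (V × C) ≃L[ℝ] E) {M : E' →L[ℝ] E} (hM : HasMFDerivAt J I (fun g : G => g • x) 1 M)
    (hL : ∀ p, L p = M (S p.1) + K p.2) :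
    Nonempty (SliceChart J I x (1 : G) V C) := by
  have : IsManifold J ∞ G := ContMDiffMul.toIsManifold (I := J)
  let μ : G → X := fun g => g • x
  obtain ⟨s, a, ha, ha0, hs, hs0, hsd⟩ := exists_contMDiffOn_hasMFDerivAt (I := J) (1 : G) S
  obtain ⟨κ, b, hb, hb0, hκ, hκ0, hκd⟩ := exists_contMDiffOn_hasMFDerivAt (I := I) x K
  let f : V × C → X := fun p => s p.1 • κ p.2
  have hf : ContMDiffOn 𝓘(ℝ, V × C) I ∞ f (a ×ˢ b) := by
    refine ContMDiffOn.smul (I := J) (f := fun p : V × C => s p.1) (g := fun p : V × C => κ p.2)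
      ?_ ?_
    · exact hs.comp (ContinuousLinearMap.fst ℝ V C).contMDiff.contMDiffOn fun p hp => hp.1
    · exact hκ.comp (ContinuousLinearMap.snd ℝ V C).contMDiff.contMDiffOn fun p hp => hp.2
  have h0 : (0 : V × C) ∈ a ×ˢ b := ⟨ha0, hb0⟩
  have hfd := ((hf.contMDiffAt ((ha.prod hb).mem_nhds h0)).mdifferentiableAt
    (by simp)).hasMFDerivAt
  let D : V × C →L[ℝ] E := mfderiv 𝓘(ℝ, V × C) I f 0
  have hD1 : ∀ u, D (u, 0) = M (S u) := by
    intro u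
    have h1 := hfd.comp (0 : V) (ContinuousLinearMap.inl ℝ V C).hasMFDerivAt
    have h2 : HasMFDerivAt J I μ (s 0) M := by
      rw [hs0]; exact hM
    have h3 := h2.comp (0 : V) hsd
    have h4 : f ∘ (ContinuousLinearMap.inl ℝ V C : V → V × C) = μ ∘ s := by
      funext v
      simp [f, μ, hκ0]
    rw [h4] at h1
    exact DFunLike.congr_fun (hasMFDerivAt_unique h1 h3) u
  have hD2 : ∀ z, D (0, z) = K z := by
    intro z
    have h1 := hfd.comp (0 : C) (ContinuousLinearMap.inr ℝ V C).hasMFDerivAt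
    have h4 : f ∘ Prod.mk (0 : V) = κ := by
      funext v
      simp [f, hs0]
    rw [h4] at h1
    exact DFunLike.congr_fun (hasMFDerivAt_unique h1 hκd) z
  have hDL : D = L := by
    refine ContinuousLinearMap.ext fun p => ?_
    have : p = (p.1, 0) + (0, p.2) := by simp
    rw [this, map_add, hD1, hD2, ← this]
    exact (hL p).symm
  obtain ⟨e, he0, hes, hef, he, hesymm⟩ :=
    exists_chart_of_hasMFDerivAt_equiv (ha.prod hb) hf h0 L (hDL ▸ hfd)
  have h1x : (1 : G) • x = e.symm 0 := by
    rw [hef 0 he0]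
    simp [f, hs0, hκ0]
  refine ⟨{
    chart := e
    lift := s
    contMDiffOn_chart := he
    contMDiffOn_symm := hesymm
    contMDiffOn_lift := hs.mono fun u hu => (hes hu).1
    lift_smul := fun u hu => ?_
    isOpen_level := isOpen_level_of_product_chart (J := J) (I := I) hV e he ha hs
      (fun p hp => (hes hp).1) hef
    mem_source := h1x ▸ e.map_target he0
    snd_eq_zero := ?_ }⟩
  · rw [hef _ hu]
    simp [f, hκ0]
  · rw [h1x, e.right_inv he0]
    rfl

theorem exists_sliceChart_one [I.Boundaryless] [J.Boundaryless]
    [FiniteDimensional ℝ E] [FiniteDimensional ℝ E'] [LieGroup J ∞ G] [IsManifold I ∞ X]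
    [ContMDiffSMul J I ∞ G X] (x : X) :
    ∃ C : Submodule ℝ E,
      Nonempty ((EuclideanSpace ℝ (Fin (Orbit.dim J I G x)) × C) ≃L[ℝ] E) ∧
      Nonempty (SliceChart J I x (1 : G) (EuclideanSpace ℝ (Fin (Orbit.dim J I G x))) C) := by
  let M : E' →L[ℝ] E := mfderiv J I (fun g : G => g • x) (1 : G)
  obtain ⟨C, S, L, hL⟩ := exists_complement_equiv_range M.toLinearMap
  exact ⟨C, ⟨L⟩, exists_sliceChart_one_of_equiv x (by simp) S C.subtypeL L
    (hasMFDerivAt_smul_const x 1) hL⟩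

end Slice

/-! ### The orbital map as a quotient map -/

namespace Orbit

section Topology

variable {G X : Type*} [Group G] [MulAction G X] {x : X}

theorem incl_injective : Function.Injective (incl : Orbit G x → X) := Subtype.val_injective

theorem proj_surjective : Function.Surjective (proj x : G → Orbit G x) := by
  rintro ⟨_, g, rfl⟩
  exact ⟨g, rfl⟩

theorem isQuotientMap_proj [TopologicalSpace G] : Topology.IsQuotientMap (proj x : G → Orbit G x) :=
  ⟨⟨rfl⟩, proj_surjective⟩

end Topology

end Orbit

/-! ### The orbit in a slice chart -/

namespace SliceChart

open Orbit

variable {E H E' H' G X : Type*}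
  [NormedAddCommGroup E] [NormedSpace ℝ E] [TopologicalSpace H]
  {I : ModelWithCorners ℝ E H} [TopologicalSpace X] [ChartedSpace H X]
  [NormedAddCommGroup E'] [NormedSpace ℝ E'] [TopologicalSpace H']
  {J : ModelWithCorners ℝ E' H'} [Group G] [TopologicalSpace G] [ChartedSpace H' G]
  [MulAction G X] {x : X} {g : G}
  {V C : Type*} [NormedAddCommGroup V] [NormedSpace ℝ V] [NormedAddCommGroup C] [NormedSpace ℝ C]

/-- The slice chart at `g` obtained from one at the identity by translation with `g`. -/
def translate [LieGroup J ∞ G] [ContMDiffSMul J I ∞ G X] (D : SliceChart J I x (1 : G) V C)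
    (g : G) : SliceChart J I x g V C :=
  haveI := ContMDiffSMul.continuousSMul (I := J) (I' := I) (G := G) (M := X) ∞
  haveI : IsTopologicalGroup G := topologicalGroup_of_lieGroup J ∞
  { chart := (Homeomorph.smul g).symm.transOpenPartialHomeomorph D.chart
    lift := fun u => g * D.lift u
    contMDiffOn_chart := D.contMDiffOn_chart.comp
      (ContMDiffSMul.contMDiff_const_smul (I := J) g⁻¹).contMDiffOn subset_rfl
    contMDiffOn_symm :=
      (ContMDiffSMul.contMDiff_const_smul (I := J) g).comp_contMDiffOn D.contMDiffOn_symm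
    contMDiffOn_lift := contMDiff_mul_left.comp_contMDiffOn D.contMDiffOn_lift
    lift_smul := fun u hu => by
      rw [mul_smul, D.lift_smul u hu]
      rfl
    isOpen_level := fun a => by
      have h := (D.isOpen_level a).preimage (continuous_const_mul g⁻¹)
      simp only [preimage_ofPred_eq, mul_smul] at h
      exact h
    mem_source := by
      have h := D.mem_source
      rw [one_smul] at h
      change g⁻¹ • g • x ∈ D.chart.source
      rwa [inv_smul_smul]
    snd_eq_zero := by
      have h := D.snd_eq_zero
      rw [one_smul] at h
      change (D.chart (g⁻¹ • g • x)).2 = 0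
      rwa [inv_smul_smul] }

/-- A point with vanishing transverse coordinate is recovered from its coordinate in `V`. -/
theorem symm_fst_zero (D : SliceChart J I x g V C) {y : X} (hy : y ∈ D.chart.source)
    (h0 : (D.chart y).2 = 0) :
    ((D.chart y).1, (0 : C)) ∈ D.chart.target ∧ D.chart.symm ((D.chart y).1, 0) = y := by
  have h : ((D.chart y).1, (0 : C)) = D.chart y := Prod.ext rfl h0.symm
  rw [h]
  exact ⟨D.chart.map_source hy, D.chart.left_inv hy⟩

theorem isOpen_slice (D : SliceChart J I x g V C) :
    IsOpen {u : V | (u, (0 : C)) ∈ D.chart.target} :=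
  D.chart.open_target.preimage (Continuous.prodMk_left 0)

theorem isOpen_orbit_slice (D : SliceChart J I x g V C) :
    IsOpen {p : Orbit G x | p.incl ∈ D.chart.source ∧ (D.chart p.incl).2 = 0} := by
  rw [← isQuotientMap_proj.isOpen_preimage]
  exact D.isOpen_level 0

/-- The chart of the orbit given by a slice chart: its domain is the part of the orbit with vanishing
transverse coordinate, and its value is the coordinate in `V`. The domain is open in the quotient
topology because the transverse coordinate is locally constant on `G`. -/
def orbitChart [ContMDiffSMul J I ∞ G X] (D : SliceChart J I x g V C) :
    OpenPartialHomeomorph (Orbit G x) V where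
  toFun p := (D.chart p.incl).1
  invFun u := proj x (D.lift u)
  source := {p | p.incl ∈ D.chart.source ∧ (D.chart p.incl).2 = 0}
  target := {u | (u, (0 : C)) ∈ D.chart.target}
  map_source' p hp := (D.symm_fst_zero hp.1 hp.2).1
  map_target' u hu := by
    change D.lift u • x ∈ _ ∧ (D.chart (D.lift u • x)).2 = 0
    rw [D.lift_smul u hu, D.chart.right_inv hu]
    exact ⟨D.chart.map_target hu, rfl⟩
  left_inv' p hp := by
    have h := D.symm_fst_zero hp.1 hp.2
    apply incl_injective
    change D.lift _ • x = _
    rw [D.lift_smul _ h.1, h.2]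
  right_inv' u hu := by
    change (D.chart (D.lift u • x)).1 = u
    rw [D.lift_smul u hu, D.chart.right_inv hu]
  open_source := D.isOpen_orbit_slice
  open_target := D.isOpen_slice
  continuousOn_toFun := by
    refine (isQuotientMap_proj.continuousOn_isOpen_iff D.isOpen_orbit_slice).2 ?_
    refine continuous_fst.comp_continuousOn (D.chart.continuousOn.comp
      (contMDiff_smul_const (J := J) (I := I) x).continuous.continuousOn fun h hh => hh.1)
  continuousOn_invFun :=
    isQuotientMap_proj.continuous.comp_continuousOn D.contMDiffOn_lift.continuousOn

theorem proj_mem_orbitChart_source [ContMDiffSMul J I ∞ G X] (D : SliceChart J I x g V C) :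
    proj x g ∈ D.orbitChart.source := ⟨D.mem_source, D.snd_eq_zero⟩

theorem contMDiffOn_fst_chart (D : SliceChart J I x g V C) :
    ContMDiffOn I 𝓘(ℝ, V) ∞ (fun y => (D.chart y).1) D.chart.source :=
  (ContinuousLinearMap.fst ℝ V C).contMDiff.comp_contMDiffOn D.contMDiffOn_chart

theorem contMDiffOn_orbitChart_proj [ContMDiffSMul J I ∞ G X] (D : SliceChart J I x g V C) :
    ContMDiffOn J 𝓘(ℝ, V) ∞ (fun h : G => D.orbitChart (proj x h))
      (proj x ⁻¹' D.orbitChart.source) :=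
  D.contMDiffOn_fst_chart.comp (contMDiff_smul_const x).contMDiffOn fun _ hh => hh.1

theorem contMDiffOn_incl_orbitChart_symm [ContMDiffSMul J I ∞ G X] (D : SliceChart J I x g V C) :
    ContMDiffOn 𝓘(ℝ, V) I ∞ (fun v => incl (D.orbitChart.symm v)) D.orbitChart.target :=
  (contMDiff_smul_const (J := J) x).comp_contMDiffOn D.contMDiffOn_lift

/-- Smoothness of coordinate changes. Locally `φ.symm` is the orbital map composed with the smooth
map to `G` obtained by reading `incl ∘ φ.symm` in a slice chart and applying its lift, and `ψ`
composed with the orbital map is smooth. -/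
theorem contDiffOn_symm_trans [ContMDiffSMul J I ∞ G X]
    (hD : ∀ g : G, Nonempty (SliceChart J I x g V C)) {φ ψ : OpenPartialHomeomorph (Orbit G x) V}
    (hφ : ContMDiffOn 𝓘(ℝ, V) I ∞ (fun v => incl (φ.symm v)) φ.target)
    (hψ : ContMDiffOn J 𝓘(ℝ, V) ∞ (fun h : G => ψ (proj x h)) (proj x ⁻¹' ψ.source)) :
    ContDiffOn ℝ ∞ (φ.symm ≫ₕ ψ) (φ.symm ≫ₕ ψ).source := by
  rintro v ⟨hv, hvψ⟩
  change v ∈ φ.target at hv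
  change φ.symm v ∈ ψ.source at hvψ
  obtain ⟨g, hg⟩ := proj_surjective (φ.symm v)
  obtain ⟨D⟩ := hD g
  let θ := D.orbitChart
  have hvθ : φ.symm v ∈ θ.source := hg ▸ D.proj_mem_orbitChart_source
  have h1 : ContMDiffAt 𝓘(ℝ, V) 𝓘(ℝ, V) ∞ (fun w => θ (φ.symm w)) v :=
    (D.contMDiffOn_fst_chart.contMDiffAt (D.chart.open_source.mem_nhds hvθ.1)).comp v
      (f := fun w => incl (φ.symm w))
      (hφ.contMDiffAt (φ.open_target.mem_nhds hv))
  have h2 : ContMDiffAt 𝓘(ℝ, V) J ∞ D.lift (θ (φ.symm v)) :=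
    D.contMDiffOn_lift.contMDiffAt (D.isOpen_slice.mem_nhds (θ.map_source hvθ))
  have h3 : proj x (D.lift (θ (φ.symm v))) = φ.symm v := θ.left_inv hvθ
  have h4 : ContMDiffAt J 𝓘(ℝ, V) ∞ (fun h : G => ψ (proj x h)) (D.lift (θ (φ.symm v))) :=
    hψ.contMDiffAt ((ψ.open_source.preimage isQuotientMap_proj.continuous).mem_nhds
      (by rwa [mem_preimage, h3]))
  have h5 := (h4.comp v (h2.comp v h1)).contDiffAt
  refine (h5.congr_of_eventuallyEq ?_).contDiffWithinAt
  filter_upwards [(φ.symm.continuousAt hv).preimage_mem_nhds (θ.open_source.mem_nhds hvθ)]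
    with w hw
  exact congrArg ψ (θ.left_inv hw).symm

theorem isImmersionAtOfComplement_incl [I.Boundaryless] [IsManifold I ∞ X]
    [ContMDiffSMul J I ∞ G X] [ChartedSpace V (Orbit G x)]
    (D : SliceChart J I x g V C) (L : (V × C) ≃L[ℝ] E)
    (hD : D.orbitChart ∈ IsManifold.maximalAtlas 𝓘(ℝ, V) ∞ (Orbit G x)) :
    Manifold.IsImmersionAtOfComplement C 𝓘(ℝ, V) I ∞ (incl : Orbit G x → X) (proj x g) := by
  let e : OpenPartialHomeomorph X H :=
    D.chart.transHomeomorph (L.toHomeomorph.trans I.toHomeomorph.symm)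
  have he : e ∈ IsManifold.maximalAtlas I ∞ X := by
    refine e.mem_maximalAtlas_of_contMDiffOn ?_ ?_
    · refine I.contMDiffOn_symm.comp (t := range I) (f := fun y => L (D.chart y)) ?_ ?_
      · exact (L : V × C →L[ℝ] E).contMDiff.comp_contMDiffOn D.contMDiffOn_chart
      · simp [I.range_eq_univ]
    · refine D.contMDiffOn_symm.comp (f := fun y => L.symm (I y)) ?_ ?_
      · exact ((L.symm : E →L[ℝ] V × C).contMDiff.comp I.contMDiff).contMDiffOn
      · exact fun y hy => hy
  refine .mk_of_charts L D.orbitChart e D.proj_mem_orbitChart_source D.mem_source hD he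
    (fun p hp => hp.1) fun u hu => ?_
  have hu' : (u, (0 : C)) ∈ D.chart.target := by
    have h : u ∈ D.orbitChart.target := by simpa using hu
    exact h
  change I (I.symm (L (D.chart (D.lift u • x)))) = L (u, 0)
  rw [I.right_inv (by simp [I.range_eq_univ]), D.lift_smul u hu', D.chart.right_inv hu']

/-- A continuous curve in `X` that stays in the orbit and passes through `g • x` stays, locally, in
the plaque of `g • x`: the levels of the transverse coordinate are disjoint open subsets of the
separable space `G`, so only countably many are nonempty, and a continuous function on an interval
with countably many values is constant. -/
theorem eventually_mem_slice [ContMDiffSMul J I ∞ G X] [TopologicalSpace.SeparableSpace G]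
    (D : SliceChart J I x g V C) {T : Set ℝ} (hT : IsOpen T) {c : ℝ → X} (hc : ContinuousOn c T)
    (hcx : ∀ t ∈ T, c t ∈ MulAction.orbit G x) {t₀ : ℝ} (ht₀ : t₀ ∈ T) (hct : c t₀ = g • x) :
    ∀ᶠ t in nhds t₀, c t ∈ D.chart.source ∧ (D.chart (c t)).2 = 0 := by
  have hopen : IsOpen (T ∩ c ⁻¹' D.chart.source) :=
    hc.isOpen_inter_preimage hT D.chart.open_source
  obtain ⟨ε, hε, hball⟩ := Metric.isOpen_iff.1 hopen t₀ ⟨ht₀, by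
    rw [mem_preimage, hct]; exact D.mem_source⟩
  -- the transverse coordinate takes only countably many values on the orbit
  let lev : C → Set G := fun a => {h | h • x ∈ D.chart.source ∧ (D.chart (h • x)).2 = a}
  have hcount : {a | (lev a).Nonempty}.Countable := by
    refine Set.PairwiseDisjoint.countable_of_isOpen (s := lev) ?_
      (fun a _ => D.isOpen_level a) fun a ha => ha
    intro a _ b _ hab
    refine Set.disjoint_left.2 fun h ha hb => hab (ha.2.symm.trans hb.2)
  let f : ℝ → C := fun t => (D.chart (c t)).2
  have hf : ContinuousOn f (Metric.ball t₀ ε) :=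
    continuous_snd.comp_continuousOn (D.chart.continuousOn.comp
      (hc.mono fun t ht => (hball ht).1) fun t ht => (hball ht).2)
  have himage : f '' Metric.ball t₀ ε ⊆ {a | (lev a).Nonempty} := by
    rintro _ ⟨t, ht, rfl⟩
    obtain ⟨h, hh⟩ := hcx t (hball ht).1
    change h • x = c t at hh
    refine ⟨h, ?_, ?_⟩
    · rw [hh]; exact (hball ht).2
    · rw [hh]
  have hsub : (f '' Metric.ball t₀ ε).Subsingleton :=
    hcount.isTotallyDisconnected _ himage
      ((convex_ball t₀ ε).isPreconnected.image f hf)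
  filter_upwards [Metric.ball_mem_nhds t₀ hε] with t ht
  refine ⟨(hball ht).2, ?_⟩
  have h := hsub (mem_image_of_mem f ht) (mem_image_of_mem f (Metric.mem_ball_self hε))
  change (D.chart (c t)).2 = (D.chart (c t₀)).2 at h
  rw [h, hct, D.snd_eq_zero]

theorem contMDiffAt_proj [ContMDiffSMul J I ∞ G X] [ChartedSpace V (Orbit G x)]
    (D : SliceChart J I x g V C)
    (hD : D.orbitChart ∈ IsManifold.maximalAtlas 𝓘(ℝ, V) ∞ (Orbit G x))
    [IsManifold 𝓘(ℝ, V) ∞ (Orbit G x)] :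
    ContMDiffAt J 𝓘(ℝ, V) ∞ (proj x : G → Orbit G x) g := by
  have hopen : IsOpen (proj x ⁻¹' D.orbitChart.source : Set G) :=
    D.orbitChart.open_source.preimage isQuotientMap_proj.continuous
  have hmem := hopen.mem_nhds D.proj_mem_orbitChart_source
  have h1 := contMDiffAt_symm_of_mem_maximalAtlas hD
    (D.orbitChart.map_source D.proj_mem_orbitChart_source)
  refine (h1.comp g (D.contMDiffOn_orbitChart_proj.contMDiffAt hmem)).congr_of_eventuallyEq ?_
  filter_upwards [hmem] with h hh
  exact (D.orbitChart.left_inv hh).symm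

theorem contMDiffAt_curve [ContMDiffSMul J I ∞ G X] [TopologicalSpace.SeparableSpace G]
    [ChartedSpace V (Orbit G x)] [IsManifold 𝓘(ℝ, V) ∞ (Orbit G x)]
    (D : SliceChart J I x g V C)
    (hD : D.orbitChart ∈ IsManifold.maximalAtlas 𝓘(ℝ, V) ∞ (Orbit G x))
    {k : ℕ∞} {T : Set ℝ} (hT : IsOpen T) {γ : ℝ → Orbit G x}
    (hγ : ContMDiffOn 𝓘(ℝ, ℝ) I k (fun t => (γ t).incl) T) {t₀ : ℝ} (ht₀ : t₀ ∈ T)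
    (hγt : γ t₀ = proj x g) : ContMDiffAt 𝓘(ℝ, ℝ) 𝓘(ℝ, V) k γ t₀ := by
  have hsrc : γ t₀ ∈ D.orbitChart.source := hγt ▸ D.proj_mem_orbitChart_source
  have hk : (k : WithTop ℕ∞) ≤ ∞ := by exact_mod_cast le_top
  have h1 : ContMDiffAt 𝓘(ℝ, ℝ) 𝓘(ℝ, V) k (fun t => D.orbitChart (γ t)) t₀ :=
    ((D.contMDiffOn_fst_chart.contMDiffAt (D.chart.open_source.mem_nhds hsrc.1)).of_le hk).comp t₀
      (f := fun t => (γ t).incl)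
      (hγ.contMDiffAt (hT.mem_nhds ht₀))
  have h2 := (contMDiffAt_symm_of_mem_maximalAtlas hD (D.orbitChart.map_source hsrc)).of_le hk
  refine (h2.comp t₀ h1).congr_of_eventuallyEq ?_
  filter_upwards [D.eventually_mem_slice hT hγ.continuousOn (fun t _ => (γ t).2) ht₀
    (congrArg incl hγt)] with t ht
  exact (D.orbitChart.left_inv ht).symm

end SliceChart

theorem corollary1
    {E H E' H' G X : Type*}
    -- a finite-dimensional smooth manifold `X`, not necessarily Hausdorff or second countable
    [NormedAddCommGroup E] [NormedSpace ℝ E] [FiniteDimensional ℝ E] [TopologicalSpace H]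
    (I : ModelWithCorners ℝ E H) [I.Boundaryless]
    [TopologicalSpace X] [ChartedSpace H X] [IsManifold I ∞ X]
    -- a finite-dimensional separable Lie group `G`
    [NormedAddCommGroup E'] [NormedSpace ℝ E'] [FiniteDimensional ℝ E'] [TopologicalSpace H']
    (J : ModelWithCorners ℝ E' H') [J.Boundaryless]
    [Group G] [TopologicalSpace G] [ChartedSpace H' G] [LieGroup J ∞ G]
    [TopologicalSpace.SeparableSpace G]
    -- a smooth action of `G` on `X`
    [MulAction G X] (hsmul : ContMDiff (J.prod I) I ∞ (fun p : G × X => p.1 • p.2))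
    (x : X) :
    -- the smooth atlas of `Gx` makes `Gx` a manifold, immersed in `X`, with smooth `G → Gx`
    ∃ _ : ChartedSpace (EuclideanSpace ℝ (Fin (Orbit.dim J I G x))) (Orbit G x),
      atlas (EuclideanSpace ℝ (Fin (Orbit.dim J I G x))) (Orbit G x) =
        Orbit.smoothAtlas J I G x ∧
      IsManifold 𝓘(ℝ, EuclideanSpace ℝ (Fin (Orbit.dim J I G x))) ∞ (Orbit G x) ∧
      Manifold.IsImmersion 𝓘(ℝ, EuclideanSpace ℝ (Fin (Orbit.dim J I G x))) I ∞
        (Orbit.incl : Orbit G x → X) ∧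
      ContMDiff J 𝓘(ℝ, EuclideanSpace ℝ (Fin (Orbit.dim J I G x))) ∞
        (Orbit.proj x : G → Orbit G x) ∧
      -- every `C^k` curve in `X` based at `x` with image in `Gx` is a `C^k` curve in `Gx`
      ∀ (k : ℕ∞), 1 ≤ k →
        ∀ (T : Set ℝ), IsOpen T → T.OrdConnected → (0 : ℝ) ∈ T →
        ∀ (c : ℝ → X), c 0 = x → ContMDiffOn 𝓘(ℝ, ℝ) I k c T →
          (∀ t ∈ T, c t ∈ MulAction.orbit G x) →
          ∃ γ : ℝ → Orbit G x, (∀ t ∈ T, (γ t).incl = c t) ∧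
            ContMDiffOn 𝓘(ℝ, ℝ) 𝓘(ℝ, EuclideanSpace ℝ (Fin (Orbit.dim J I G x))) k γ T := by
  have : ContMDiffSMul J I ∞ G X := ⟨hsmul⟩
  obtain ⟨C, ⟨L⟩, ⟨D₁⟩⟩ := exists_sliceChart_one (J := J) (I := I) (G := G) x
  let D := D₁.translate
  have hatlas : ∀ g, (D g).orbitChart ∈ Orbit.smoothAtlas J I G x := fun g =>
    ⟨(D g).contMDiffOn_orbitChart_proj, (D g).contMDiffOn_incl_orbitChart_symm⟩
  choose s hs using (Orbit.proj_surjective : Function.Surjective (Orbit.proj x : G → Orbit G x))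
  let inst : ChartedSpace (EuclideanSpace ℝ (Fin (Orbit.dim J I G x))) (Orbit G x) :=
    { atlas := Orbit.smoothAtlas J I G x
      chartAt := fun p => (D (s p)).orbitChart
      mem_chart_source := fun p => by
        have h := (D (s p)).proj_mem_orbitChart_source
        rwa [hs p] at h
      chart_mem_atlas := fun p => hatlas _ }
  have hman : IsManifold 𝓘(ℝ, EuclideanSpace ℝ (Fin (Orbit.dim J I G x))) ∞ (Orbit G x) := by
    refine isManifold_of_contDiffOn _ _ _ fun φ ψ hφ hψ => ?_
    have h := SliceChart.contDiffOn_symm_trans (fun g => ⟨D g⟩) hφ.2 hψ.1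
    simpa using h
  have hmax : ∀ g, (D g).orbitChart ∈ IsManifold.maximalAtlas
      𝓘(ℝ, EuclideanSpace ℝ (Fin (Orbit.dim J I G x))) ∞ (Orbit G x) :=
    fun g => IsManifold.subset_maximalAtlas (hatlas g)
  refine ⟨inst, rfl, hman, ⟨C, inferInstance, inferInstance, fun p => ?_⟩,
    fun g => (D g).contMDiffAt_proj (hmax g), ?_⟩
  · obtain ⟨g, rfl⟩ := Orbit.proj_surjective p
    exact (D g).isImmersionAtOfComplement_incl L (hmax g)
  · intro k _ T hT _ _ c _ hc hcx
    have hlift : ∀ t, ∃ p : Orbit G x, t ∈ T → p.incl = c t := fun t => by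
      by_cases ht : t ∈ T
      · exact ⟨⟨c t, hcx t ht⟩, fun _ => rfl⟩
      · exact ⟨Orbit.proj x 1, fun h => absurd h ht⟩
    choose γ hγ using hlift
    refine ⟨γ, hγ, fun t₀ ht₀ => ?_⟩
    obtain ⟨g, hg⟩ := Orbit.proj_surjective (γ t₀)
    exact ((D g).contMDiffAt_curve (hmax g) hT (hc.congr hγ) ht₀ hg.symm).contMDiffWithinAt
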